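/- **Setting.** Let $n\ge 2$ and let $(M,P,g)$ be a Riemannian almost product manifold of dimension $2n$ with $\operatorname{tr}P=0$: $M$ is a smooth manifold, $g$ a smooth Riemannian metric and $P$ a smooth field of endomorphisms of the tangent spaces with $P^2=\mathrm{id}$ and $g(Px,Py)=g(x,y)$. Let $\nabla$ be the Levi-Civita connection of $g$, $F(x,y,z)=g((\nabla_xP)y,z)$, let $\theta$ be the 1-form $\theta(x)=g^{ij}F(e_i,e_j,x)$, where $(e_i)$ is a basis of the tangent space and $(g^{ij})$ is the inverse of the matrix $(g(e_i,e_j))$, and let $\Omega$ be the vector field with $g(\Omega,x)=\theta(x)$. Assume that $(M,P,g)$ is a conformal Riemannian $P$-manifold ($\mathcal W_1$-manifold), i.e. $$F(x,y,z)=\tfrac1{2n}\{g(x,y)\theta(z)-g(x,Py)\theta(Pz)+g(x,z)\theta(y)-g(x,Pz)\theta(Py)\}.$$ For $\lambda,\mu\in\mathbb R$ let $\nabla'$ be the linear connection $$\nabla'_xy=\nabla_xy+g(x,Py)\{\lambda P\Omega+\mu\Omega\}-\{\lambda\theta(Py)+\mu\theta(y)\}Px+g(x,y)\{\lambda\Omega+(\mu+\tfrac1{2n})P\Omega\}-\{\lambda\theta(y)+(\mu+\tfrac1{2n})\theta(Py)\}x,$$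 with curvature tensor $R'(x,y)z=\nabla'_x\nabla'_yz-\nabla'_y\nabla'_xz-\nabla'_{[x,y]}z$ and $R'(x,y,z,w)=g(R'(x,y)z,w)$. A $(0,4)$-tensor $L$ is a *Riemannian $P$-tensor* if $L(x,y,z,w)=-L(y,x,z,w)=-L(x,y,w,z)$, $L(x,y,z,w)+L(y,z,x,w)+L(z,x,y,w)=0$ and $L(x,y,Pz,Pw)=L(x,y,z,w)$ for all vector fields $x,y,z,w$. **Proposition 4.2.** The curvature tensor $R'$ of $\nabla'$ is a Riemannian $P$-tensor if and only if for all smooth vector fields $y,z$ on $M$ $$\lambda\{(\nabla_y\theta)z-(\nabla_z\theta)y\}+\left(\mu+\tfrac1{2n}\right)\{(\nabla_y\theta)Pz-(\nabla_z\theta)Py\}=0,$$ $$\mu\{(\nabla_y\theta)z-(\nabla_z\theta)y\}+\lambda\{(\nabla_y\theta)Pz-(\nabla_z\theta)Py\}=0.$$ -/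

import Mathlib

open Bundle
open scoped Manifold ContDiff

noncomputable section

namespace RiemannianAlmostProduct

variable {E : Type*} [NormedAddCommGroup E] [NormedSpace ℝ E] [FiniteDimensional ℝ E]
  [CompleteSpace E]
  {H : Type*} [TopologicalSpace H] {I : ModelWithCorners ℝ E H}
  {M : Type*} [TopologicalSpace M] [ChartedSpace H M] [IsManifold I ∞ M]

instance instFiniteDimensionalTangentSpace (x : M) : FiniteDimensional ℝ (TangentSpace I x) :=
  inferInstanceAs (FiniteDimensional ℝ E)

instance instT2SpaceTangentSpace (x : M) : T2Space (TangentSpace I x) :=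
  inferInstanceAs (T2Space E)

variable (I M) in
/-- The smooth vector fields on `M`. -/
abbrev SmoothVectorField : Type _ := ContMDiffSection I E ∞ (fun x : M => TangentSpace I x)

variable (I M) in
/-- Smooth Riemannian metrics on `M`; the metric is `g.inner x u v`. -/
abbrev Metric : Type _ := ContMDiffRiemannianMetric I ∞ E (fun x : M => TangentSpace I x)

variable (I M) in
/-- Linear connections on `M`. In Mathlib's argument order `D Y x (X x)` is the value at `x` of the
covariant derivative of `Y` in the direction `X`. -/
abbrev LinearConnection : Type _ := CovariantDerivative I E (fun x : M => TangentSpace I x)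

/-- `D` is the Levi-Civita connection of `g`: the smooth linear connection that is torsion-free
and satisfies `v (g (Y, Z)) = g (D_v Y, Z) + g (Y, D_v Z)`. -/
structure IsLeviCivita (g : Metric I M) (D : LinearConnection I M) : Prop where
  smooth : D.ContMDiffCovariantDerivative ∞
  torsion_eq_zero : D.torsion = 0
  metric : ∀ (Y Z : SmoothVectorField I M) (x : M) (v : TangentSpace I x),
    mvfderiv I (fun q => g.inner q (Y q) (Z q)) x v =
      g.inner x (D Y x v) (Z x) + g.inner x (Y x) (D Z x v)

/-- A smooth field of endomorphisms `P` of the tangent spaces which makes `(M, P, g)` a Riemannian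
almost product manifold with `tr P = 0`. -/
structure AlmostProductStructure (g : Metric I M) where
  toFun : ∀ x : M, TangentSpace I x →L[ℝ] TangentSpace I x
  contMDiff : ContMDiff I (I.prod 𝓘(ℝ, E →L[ℝ] E)) ∞
    (fun x => TotalSpace.mk' (E →L[ℝ] E)
      (E := fun x : M => TangentSpace I x →L[ℝ] TangentSpace I x) x (toFun x))
  involutive : ∀ (x : M) (u : TangentSpace I x), toFun x (toFun x u) = u
  isometry : ∀ (x : M) (u v : TangentSpace I x),
    g.inner x (toFun x u) (toFun x v) = g.inner x u v
  trace_eq_zero : ∀ x : M, LinearMap.trace ℝ (TangentSpace I x) (toFun x).toLinearMap = 0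

instance instCoeFunAlmostProductStructure (g : Metric I M) :
    CoeFun (AlmostProductStructure g)
      (fun _ => ∀ x : M, TangentSpace I x →L[ℝ] TangentSpace I x) :=
  ⟨AlmostProductStructure.toFun⟩

section

variable {g : Metric I M}

theorem AlmostProductStructure.mdifferentiableAt_apply (P : AlmostProductStructure g)
    {Y : ∀ x : M, TangentSpace I x} {x : M} (hY : MDiffAt (T% Y) x) :
    MDiffAt (T% (fun q => P q (Y q))) x :=
  MDifferentiableAt.clm_bundle_apply (F₁ := E) (F₂ := E)
    (P.contMDiff.mdifferentiable (by simp) x) hY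

theorem tensorialAt_nabla (P : AlmostProductStructure g) (D : LinearConnection I M) (x : M) :
    TensorialAt I E (fun Y : ∀ x : M, TangentSpace I x =>
      D (fun q => P q (Y q)) x - (P x).comp (D Y x)) x where
  smul {f Y} hf hY := by
    have h1 : (fun q => P q ((f • Y) q)) = f • (fun q => P q (Y q)) := by
      funext q; simp
    simp only [h1]
    rw [D.isCovariantDerivativeOnUniv.leibniz (P.mdifferentiableAt_apply hY) hf,
      D.isCovariantDerivativeOnUniv.leibniz hY hf]
    ext v
    simp
    module
  add {Y Y'} hY hY' := by
    have h1 : (fun q => P q ((Y + Y') q)) = (fun q => P q (Y q)) + (fun q => P q (Y' q)) := by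
      funext q; simp
    simp only [h1]
    rw [D.isCovariantDerivativeOnUniv.add (P.mdifferentiableAt_apply hY)
      (P.mdifferentiableAt_apply hY'), D.isCovariantDerivativeOnUniv.add hY hY']
    ext v
    simp
    module

/-- The tensor field `D P`; `nablaP P D x v u` is `(D_u P) v`. -/
def nablaP (P : AlmostProductStructure g) (D : LinearConnection I M) (x : M) :
    TangentSpace I x →L[ℝ] TangentSpace I x →L[ℝ] TangentSpace I x :=
  TensorialAt.mkHom _ x (tensorialAt_nabla P D x)

theorem nablaP_apply (P : AlmostProductStructure g) (D : LinearConnection I M)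
    {Y : ∀ x : M, TangentSpace I x} {x : M} (hY : MDiffAt (T% Y) x) (u : TangentSpace I x) :
    nablaP P D x (Y x) u = D (fun q => P q (Y q)) x u - P x (D Y x u) := by
  unfold nablaP
  rw [TensorialAt.mkHom_apply _ hY]
  rfl

/-- The tensor `F (u, v, w) = g ((D_u P) v, w)`. -/
def tensorF (P : AlmostProductStructure g) (D : LinearConnection I M) (x : M)
    (u v w : TangentSpace I x) : ℝ :=
  g.inner x (nablaP P D x v u) w

/-- The components `g^{ij}` of the inverse matrix of `g` at `x`, with respect to a basis `e` of the
tangent space. -/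
def inverseMetric (g : Metric I M) (x : M) {ι : Type*} [Fintype ι] [DecidableEq ι]
    (e : Module.Basis ι ℝ (TangentSpace I x)) : Matrix ι ι ℝ :=
  (Matrix.of fun i j => g.inner x (e i) (e j))⁻¹

/-- The vector `Ω = g^{ij} (D_{e_i} P) e_j`. It is dual to the associated 1-form, see
`inner_leeVector`. -/
def leeVector (P : AlmostProductStructure g) (D : LinearConnection I M) (x : M) :
    TangentSpace I x :=
  let e := Module.finBasis ℝ (TangentSpace I x)
  ∑ i, ∑ j, inverseMetric g x e i j • nablaP P D x (e j) (e i)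

/-- The associated 1-form `θ = g(Ω, ·)`, that is, `θ (z) = g^{ij} F (e_i, e_j, z)`, see
`leeForm_apply`. -/
def leeForm (P : AlmostProductStructure g) (D : LinearConnection I M) (x : M) :
    TangentSpace I x →L[ℝ] ℝ :=
  g.inner x (leeVector P D x)

theorem leeForm_apply (P : AlmostProductStructure g) (D : LinearConnection I M) (x : M)
    (z : TangentSpace I x) :
    leeForm P D x z =
      ∑ i, ∑ j, inverseMetric g x (Module.finBasis ℝ (TangentSpace I x)) i j *
        tensorF P D x (Module.finBasis ℝ (TangentSpace I x) i)
          (Module.finBasis ℝ (TangentSpace I x) j) z := by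
  simp [leeForm, leeVector, tensorF, map_sum]

theorem inner_leeVector (P : AlmostProductStructure g) (D : LinearConnection I M) (x : M)
    (z : TangentSpace I x) : g.inner x (leeVector P D x) z = leeForm P D x z :=
  rfl

/-- `(M, P, g)`, of dimension `2 n` and with Levi-Civita connection `D`, is a conformal Riemannian
`P`-manifold (belongs to the class `W₁`). -/
def IsW1Manifold (n : ℕ) (P : AlmostProductStructure g) (D : LinearConnection I M) : Prop :=
  ∀ (p : M) (x y z : TangentSpace I p),
    tensorF P D p x y z = 1 / (2 * (n : ℝ)) *
      (g.inner p x y * leeForm P D p z - g.inner p x (P p y) * leeForm P D p (P p z)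
        + g.inner p x z * leeForm P D p y - g.inner p x (P p z) * leeForm P D p (P p y))

/-- The difference tensor `Q` of the connection with parameters `lam`, `mu`;
`differenceTensor n P D lam mu p y x` is `Q (x, y)`, see `differenceTensor_apply`. -/
def differenceTensor (n : ℕ) (P : AlmostProductStructure g) (D : LinearConnection I M)
    (lam mu : ℝ) (p : M) :
    TangentSpace I p →L[ℝ] TangentSpace I p →L[ℝ] TangentSpace I p :=
  LinearMap.toContinuousBilinearMap <| LinearMap.mk₂ ℝ
    (fun y x : TangentSpace I p =>
      g.inner p x (P p y) • (lam • P p (leeVector P D p) + mu • leeVector P D p)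
        - (lam * leeForm P D p (P p y) + mu * leeForm P D p y) • P p x
        + g.inner p x y •
            (lam • leeVector P D p + (mu + 1 / (2 * (n : ℝ))) • P p (leeVector P D p))
        - (lam * leeForm P D p y + (mu + 1 / (2 * (n : ℝ))) * leeForm P D p (P p y)) • x)
    (fun y y' x => by simp only [map_add]; module)
    (fun c y x => by simp only [map_smul, smul_eq_mul]; module)
    (fun y x x' => by simp only [map_add, add_apply]; module)
    (fun c y x => by
      simp only [map_smul, smul_apply, smul_eq_mul]; module)

theorem differenceTensor_apply (n : ℕ) (P : AlmostProductStructure g) (D : LinearConnection I M)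
    (lam mu : ℝ) (p : M) (x y : TangentSpace I p) :
    differenceTensor n P D lam mu p y x =
      g.inner p x (P p y) • (lam • P p (leeVector P D p) + mu • leeVector P D p)
        - (lam * leeForm P D p (P p y) + mu * leeForm P D p y) • P p x
        + g.inner p x y •
            (lam • leeVector P D p + (mu + 1 / (2 * (n : ℝ))) • P p (leeVector P D p))
        - (lam * leeForm P D p y + (mu + 1 / (2 * (n : ℝ))) * leeForm P D p (P p y)) • x :=
  rfl

/-- The connection `D' = D + Q` with parameters `lam`, `mu`, see `naturalConnection_apply`. -/
def naturalConnection (n : ℕ) (P : AlmostProductStructure g) (D : LinearConnection I M)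
    (lam mu : ℝ) : LinearConnection I M :=
  D.addOneForm (differenceTensor n P D lam mu)

theorem naturalConnection_apply (n : ℕ) (P : AlmostProductStructure g) (D : LinearConnection I M)
    (lam mu : ℝ) (X Y : ∀ x : M, TangentSpace I x) (p : M) :
    naturalConnection n P D lam mu Y p (X p) =
      D Y p (X p)
        + g.inner p (X p) (P p (Y p)) • (lam • P p (leeVector P D p) + mu • leeVector P D p)
        - (lam * leeForm P D p (P p (Y p)) + mu * leeForm P D p (Y p)) • P p (X p)
        + g.inner p (X p) (Y p) •
            (lam • leeVector P D p + (mu + 1 / (2 * (n : ℝ))) • P p (leeVector P D p))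
        - (lam * leeForm P D p (Y p)
            + (mu + 1 / (2 * (n : ℝ))) * leeForm P D p (P p (Y p))) • X p := by
  have h : naturalConnection n P D lam mu Y p (X p) =
      D Y p (X p) + differenceTensor n P D lam mu p (Y p) (X p) := rfl
  rw [h, differenceTensor_apply]
  module

end

/-- `R (X, Y) Z = D_X D_Y Z - D_Y D_X Z - D_[X, Y] Z`. -/
def curvature (D : LinearConnection I M) (X Y Z : ∀ x : M, TangentSpace I x) (x : M) :
    TangentSpace I x :=
  D (fun q => D Z q (Y q)) x (X x) - D (fun q => D Z q (X q)) x (Y x)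
    - D Z x (VectorField.mlieBracket I X Y x)

/-- `R (X, Y, Z, W) = g (R (X, Y) Z, W)`, as a function on `M`. -/
def curvature04 (g : Metric I M) (D : LinearConnection I M)
    (X Y Z W : ∀ x : M, TangentSpace I x) (x : M) : ℝ :=
  g.inner x (curvature D X Y Z x) (W x)

/-- `(D_Y θ) Z = Y (θ (Z)) - θ (D_Y Z)` for a 1-form `θ`, as a function on `M`. -/
def nablaForm (D : LinearConnection I M) (θ : ∀ x : M, TangentSpace I x →L[ℝ] ℝ)
    (Y Z : ∀ x : M, TangentSpace I x) (x : M) : ℝ :=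
  mvfderiv I (fun q => θ q (Z q)) x (Y x) - θ x (D Z x (Y x))

/-- The `(0,4)`-tensor `L`, given by its values on vector fields, is curvature-like. -/
structure IsCurvatureLike
    (L : (∀ x : M, TangentSpace I x) → (∀ x : M, TangentSpace I x) →
      (∀ x : M, TangentSpace I x) → (∀ x : M, TangentSpace I x) → M → ℝ) : Prop where
  antisymm_left : ∀ (X Y Z W : SmoothVectorField I M) (p : M), L X Y Z W p = -L Y X Z W p
  antisymm_right : ∀ (X Y Z W : SmoothVectorField I M) (p : M), L X Y Z W p = -L X Y W Z p
  bianchi : ∀ (X Y Z W : SmoothVectorField I M) (p : M),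
    L X Y Z W p + L Y Z X W p + L Z X Y W p = 0

/-- The `(0,4)`-tensor `L`, given by its values on vector fields, is a Riemannian `P`-tensor. -/
structure IsRiemannianPTensor {g : Metric I M} (P : AlmostProductStructure g)
    (L : (∀ x : M, TangentSpace I x) → (∀ x : M, TangentSpace I x) →
      (∀ x : M, TangentSpace I x) → (∀ x : M, TangentSpace I x) → M → ℝ) : Prop where
  curvatureLike : IsCurvatureLike L
  invariant : ∀ (X Y Z W : SmoothVectorField I M) (p : M),
    L X Y (fun q => P q (Z q)) (fun q => P q (W q)) p = L X Y Z W p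

end RiemannianAlmostProduct

end

noncomputable section

namespace RiemannianAlmostProduct

set_option linter.unusedSectionVars false

variable {E : Type*} [NormedAddCommGroup E] [NormedSpace ℝ E] [FiniteDimensional ℝ E]
  [CompleteSpace E]
  {H : Type*} [TopologicalSpace H] {I : ModelWithCorners ℝ E H}
  {M : Type*} [TopologicalSpace M] [ChartedSpace H M] [IsManifold I ∞ M]

open VectorField

/-! ### Smooth vector fields and directional derivatives -/

/-! Put α = λ θ∘P + μθ and β = (μ + 1/2n) θ∘P + λθ. The connection ∇' is metric, makes P parallel,
and has torsion α(X)PY − α(Y)PX + β(X)Y − β(Y)X. Hence R' is automatically skew in each pair of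
arguments and P-invariant, and only the first Bianchi identity can fail. By `curvature_bianchi` its
defect is explicit: the cyclic sum of R'(X,Y)Z equals the cyclic sum of dα(X,Y)PZ + dβ(X,Y)Z. The
two conditions of the theorem say dβ = 0 and dα = 0. Indeed θ((∇_X P)Y) is symmetric in X and Y on a
W₁-manifold, so d(θ∘P)(X,Y) = (∇_X θ)(PY) − (∇_Y θ)(PX).

It remains to recover dα = dβ = 0 from the vanishing of the cyclic sum. Let V_ε be the
ε-eigendistribution of P, of rank n ≥ 2. For X in V_{−ε} and Y in V_ε, choose Z in V_ε orthogonal to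
Y at the point; pairing the cyclic sum with Z gives (dβ + ε dα)(X,Y) = 0. For two fields in the same
V_ε nothing has to be assumed, since dθ vanishes there on every W₁-manifold
(`extDeriv_leeForm_eq_zero`). The reason is that V_ε is integrable and the flat Bott connection on
V_{−ε} along its leaves scales g conformally with factor proportional to θ; flatness forces this
factor to be closed along the leaves. -/

/-- A field of tangent vectors is smooth. -/
abbrev IsSmoothField (X : ∀ x : M, TangentSpace I x) : Prop :=
  ContMDiff I I.tangent ∞ (T% X)

/-- The derivative `X f` of a function along a vector field. -/
def lieDer (X : ∀ x : M, TangentSpace I x) (f : M → ℝ) : M → ℝ :=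
  fun q => mvfderiv I f q (X q)

theorem IsSmoothField.mdiffAt {X : ∀ x : M, TangentSpace I x} (hX : IsSmoothField X) (p : M) :
    MDiffAt (T% X) p :=
  hX.mdifferentiable (by simp) p

/-- A local extension of v is cut off by a bump function; the Hausdorff hypothesis makes the cut-off
globally smooth. -/
theorem exists_isSmoothField [T2Space M] (p : M) (v : TangentSpace I p) :
    ∃ Z : ∀ x : M, TangentSpace I x, IsSmoothField Z ∧ Z p = v := by
  obtain ⟨s, hs, hsm⟩ := FiberBundle.exists_contMDiffOn_extend (k := ∞) I E v
  obtain ⟨u, hus, hu, hpu⟩ := mem_nhds_iff.1 hs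
  obtain ⟨f, -, hf⟩ := (SmoothBumpFunction.nhds_basis_tsupport (I := I) p).mem_iff.1 (hu.mem_nhds hpu)
  refine ⟨(f : M → ℝ) • FiberBundle.extend E v, ?_, ?_⟩
  · exact ContMDiffOn.smul_section_of_tsupport f.contMDiff.contMDiffOn hu hf (hsm.mono hus)
  · simp

theorem IsSmoothField.lieDer {X : ∀ x : M, TangentSpace I x} (hX : IsSmoothField X) {f : M → ℝ}
    (hf : ContMDiff I 𝓘(ℝ) ∞ f) : ContMDiff I 𝓘(ℝ) ∞ (lieDer X f) := by
  have h1 := (hf.contMDiff_tangentMap (m := ∞) (by simp)).comp hX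
  exact (contMDiff_snd_tangentBundle_modelSpace ℝ 𝓘(ℝ)).comp h1

theorem contMDiff_real_smul {f : M → ℝ} (c : ℝ) (hf : ContMDiff I 𝓘(ℝ) ∞ f) :
    ContMDiff I 𝓘(ℝ) ∞ (c • f) :=
  ContMDiff.mul (f := fun _ => c) contMDiff_const hf

theorem lieDer_add {X : ∀ x : M, TangentSpace I x} {f f' : M → ℝ}
    (hf : ContMDiff I 𝓘(ℝ) ∞ f) (hf' : ContMDiff I 𝓘(ℝ) ∞ f') :
    lieDer X (f + f') = lieDer X f + lieDer X f' := by
  funext p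
  simp [lieDer, mvfderiv_add (hf.mdifferentiable (by simp) p) (hf'.mdifferentiable (by simp) p)]

theorem lieDer_mul {X : ∀ x : M, TangentSpace I x} {f f' : M → ℝ}
    (hf : ContMDiff I 𝓘(ℝ) ∞ f) (hf' : ContMDiff I 𝓘(ℝ) ∞ f') :
    lieDer X (f * f') = f * lieDer X f' + f' * lieDer X f := by
  funext p
  simp [lieDer, mvfderiv_mul (hf.mdifferentiable (by simp) p) (hf'.mdifferentiable (by simp) p)]

theorem lieDer_smul {X : ∀ x : M, TangentSpace I x} {f : M → ℝ} (c : ℝ)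
    (hf : ContMDiff I 𝓘(ℝ) ∞ f) : lieDer X (c • f) = c • lieDer X f := by
  have := lieDer_mul (X := X) (f := fun _ => c) contMDiff_const hf
  have h0 : lieDer X (fun _ : M => c) = 0 := by
    funext p
    simp [lieDer, mvfderiv_const]
  rw [h0, mul_zero, add_zero] at this
  exact this

theorem IsSmoothField.mlieBracket {X Y : ∀ x : M, TangentSpace I x} (hX : IsSmoothField X)
    (hY : IsSmoothField Y) : IsSmoothField (mlieBracket I X Y) := by
  have : IsManifold I (((⊤ : ℕ∞) : WithTop ℕ∞) + 1) M := by simpa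
  have : IsManifold I (minSmoothness ℝ 2) M := by
    simp only [minSmoothness_of_isRCLikeNormedField]; infer_instance
  exact ContDiff.mlieBracket_vectorField (m := ⊤) (n := ⊤) hX hY (by simp)

theorem mlieBracket_jacobi {X Y Z : ∀ x : M, TangentSpace I x} (hX : IsSmoothField X)
    (hY : IsSmoothField Y) (hZ : IsSmoothField Z) :
    mlieBracket I X (mlieBracket I Y Z) =
      mlieBracket I (mlieBracket I X Y) Z + mlieBracket I Y (mlieBracket I X Z) := by
  have : IsManifold I (minSmoothness ℝ 3) M := by
    simp only [minSmoothness_of_isRCLikeNormedField]; infer_instance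
  have h : minSmoothness ℝ 2 ≤ (∞ : WithTop ℕ∞) := by
    simp only [minSmoothness_of_isRCLikeNormedField]; exact ENat.LEInfty.out
  exact leibniz_identity_mlieBracket (hX.of_le h) (hY.of_le h) (hZ.of_le h)

theorem mlieBracket_smul {X Y : ∀ x : M, TangentSpace I x} {f : M → ℝ}
    (hf : ContMDiff I 𝓘(ℝ) ∞ f) (hY : IsSmoothField Y) :
    mlieBracket I X (f • Y) = lieDer X f • Y + f • mlieBracket I X Y := by
  funext p
  exact mlieBracket_smul_right (hf.mdifferentiable (by simp) p) (hY.mdiffAt p)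

theorem mlieBracket_add {X Y Y' : ∀ x : M, TangentSpace I x} (hY : IsSmoothField Y)
    (hY' : IsSmoothField Y') :
    mlieBracket I X (Y + Y') = mlieBracket I X Y + mlieBracket I X Y' := by
  funext p
  exact mlieBracket_add_right (hY.mdiffAt p) (hY'.mdiffAt p)

theorem mlieBracket_neg {X Y : ∀ x : M, TangentSpace I x} (hY : IsSmoothField Y) :
    mlieBracket I X (-Y) = -mlieBracket I X Y := by
  have h := mlieBracket_add (X := X) hY hY.neg_section
  rw [add_neg_cancel, mlieBracket_zero_right] at h
  exact (neg_eq_of_add_eq_zero_right h.symm).symm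

/-- Expand the Jacobi identity for X, Y and fZ by the Leibniz rule. The Jacobi identity for X, Y, Z
removes the terms undifferentiated in f, and what is left is the claim times Z. A field Z with Z(p)
≠ 0 exists unless the tangent space is zero, where both sides vanish. -/
theorem lieDer_mlieBracket [T2Space M] {X Y : ∀ x : M, TangentSpace I x} {f : M → ℝ}
    (hX : IsSmoothField X) (hY : IsSmoothField Y) (hf : ContMDiff I 𝓘(ℝ) ∞ f) :
    lieDer (mlieBracket I X Y) f = lieDer X (lieDer Y f) - lieDer Y (lieDer X f) := by
  funext p
  rcases subsingleton_or_nontrivial (TangentSpace I p) with h | h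
  · simp [lieDer, Subsingleton.eq_zero (X p), Subsingleton.eq_zero (Y p),
      Subsingleton.eq_zero (mlieBracket I X Y p)]
  obtain ⟨v, hv⟩ := exists_ne (0 : TangentSpace I p)
  obtain ⟨Z, hZ, rfl⟩ := exists_isSmoothField p v
  have key := mlieBracket_jacobi hX hY (hf.smul_section hZ)
  have sXZ := hX.mlieBracket hZ
  have sYZ := hY.mlieBracket hZ
  rw [mlieBracket_smul hf hZ, mlieBracket_smul hf hZ, mlieBracket_smul hf hZ,
    mlieBracket_add ((hY.lieDer hf).smul_section hZ) (hf.smul_section sYZ),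
    mlieBracket_add ((hX.lieDer hf).smul_section hZ) (hf.smul_section sXZ),
    mlieBracket_smul (hY.lieDer hf) hZ, mlieBracket_smul (hX.lieDer hf) hZ,
    mlieBracket_smul hf sYZ, mlieBracket_smul hf sXZ, mlieBracket_jacobi hX hY hZ] at key
  have h2 := congrFun key p
  simp only [Pi.add_apply, Pi.smul_apply'] at h2
  have h3 : (lieDer (mlieBracket I X Y) f p - (lieDer X (lieDer Y f) p - lieDer Y (lieDer X f) p))
      • Z p = 0 := by
    linear_combination (norm := module) -h2
  simpa [sub_eq_zero, hv] using h3

section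

/-! ### Metrics and connections acting on smooth vector fields -/

/-- The function `g (X, Y)`. -/
def innerFn (g : Metric I M) (X Y : ∀ x : M, TangentSpace I x) : M → ℝ :=
  fun q => g.inner q (X q) (Y q)

/-- The vector field `P X`. -/
def AlmostProductStructure.onField {g : Metric I M} (P : AlmostProductStructure g)
    (X : ∀ x : M, TangentSpace I x) : ∀ x : M, TangentSpace I x :=
  fun q => P q (X q)

/-- The covariant derivative of `Y` along `X`. -/
def cov (D : LinearConnection I M) (X Y : ∀ x : M, TangentSpace I x) :
    ∀ x : M, TangentSpace I x :=
  fun q => D Y q (X q)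

variable {g : Metric I M} {X Y Z W : ∀ x : M, TangentSpace I x} {f : M → ℝ}

theorem IsSmoothField.innerFn (hX : IsSmoothField X) (hY : IsSmoothField Y) :
    ContMDiff I 𝓘(ℝ) ∞ (innerFn g X Y) := by
  have : ContMDiff I (I.prod 𝓘(ℝ)) ∞
      (fun m ↦ TotalSpace.mk' ℝ (E := Bundle.Trivial M ℝ) m (g.inner m (X m) (Y m))) :=
    ContMDiff.clm_bundle_apply₂ (F₁ := E) (F₂ := E) g.contMDiff hX hY
  intro x
  have := this x
  simp only [contMDiffAt_totalSpace] at this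
  exact this.2

theorem IsSmoothField.onField (hX : IsSmoothField X) (P : AlmostProductStructure g) :
    IsSmoothField (P.onField X) :=
  ContMDiff.clm_bundle_apply (F₁ := E) (F₂ := E) P.contMDiff hX

theorem innerFn_add_left : innerFn g (X + Y) Z = innerFn g X Z + innerFn g Y Z := by
  funext p; simp [innerFn]

theorem innerFn_sub_left : innerFn g (X - Y) Z = innerFn g X Z - innerFn g Y Z := by
  funext p; simp [innerFn]

theorem innerFn_smul_left : innerFn g (f • X) Z = f * innerFn g X Z := by
  funext p; simp [innerFn]

theorem innerFn_comm : innerFn g X Y = innerFn g Y X :=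
  funext fun p => g.symm p _ _

section Cov

variable {D : LinearConnection I M}

theorem cov_add (hY : IsSmoothField Y) (hZ : IsSmoothField Z) :
    cov D X (Y + Z) = cov D X Y + cov D X Z := by
  funext p
  simp [cov, D.isCovariantDerivativeOnUniv.add (hY.mdiffAt p) (hZ.mdiffAt p)]

theorem cov_smul (hf : ContMDiff I 𝓘(ℝ) ∞ f) (hY : IsSmoothField Y) :
    cov D X (f • Y) = f • cov D X Y + lieDer X f • Y := by
  funext p
  simp [cov, lieDer,
    D.isCovariantDerivativeOnUniv.leibniz (hY.mdiffAt p) (hf.mdifferentiable (by simp) p)]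

theorem cov_const_smul {c : ℝ} (hY : IsSmoothField Y) : cov D X (c • Y) = c • cov D X Y := by
  funext p
  simp [cov, D.isCovariantDerivativeOnUniv.smul_const c (hY.mdiffAt p)]

theorem cov_sub (hY : IsSmoothField Y) (hZ : IsSmoothField Z) :
    cov D X (Y - Z) = cov D X Y - cov D X Z := by
  have h := cov_add (D := D) (X := X) (hY.sub_section hZ) hZ
  rw [sub_add_cancel] at h
  rw [h, add_sub_cancel_right]

theorem isSmoothField_cov (hD : D.ContMDiffCovariantDerivative ∞) (hX : IsSmoothField X)
    (hY : IsSmoothField Y) : IsSmoothField (cov D X Y) := by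
  have h : ContMDiff I (I.prod 𝓘(ℝ, E →L[ℝ] E)) ∞
      (fun x => TotalSpace.mk' (E →L[ℝ] E)
        (E := fun x : M => TangentSpace I x →L[ℝ] TangentSpace I x) x (D Y x)) := by
    rw [← contMDiffOn_univ]
    exact hD.contMDiff.contMDiff (by simpa using hY.contMDiffOn)
  exact ContMDiff.clm_bundle_apply (F₁ := E) (F₂ := E) h hX

/-- `D` preserves smoothness of vector fields. -/
def PreservesSmooth (D : LinearConnection I M) : Prop :=
  ∀ {X Y : ∀ x : M, TangentSpace I x}, IsSmoothField X → IsSmoothField Y →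
    IsSmoothField (cov D X Y)

/-- `D` is a metric connection. -/
def IsMetric (g : Metric I M) (D : LinearConnection I M) : Prop :=
  ∀ {X Y Z : ∀ x : M, TangentSpace I x}, IsSmoothField X → IsSmoothField Y → IsSmoothField Z →
    lieDer X (innerFn g Y Z) = innerFn g (cov D X Y) Z + innerFn g Y (cov D X Z)

/-- `P` is parallel with respect to `D`. -/
def IsParallel (P : AlmostProductStructure g) (D : LinearConnection I M) : Prop :=
  ∀ {X Y : ∀ x : M, TangentSpace I x}, IsSmoothField X → IsSmoothField Y →
    cov D X (P.onField Y) = P.onField (cov D X Y)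

/-! ### Curvature symmetries for metric connections and for parallel P -/

theorem curvature_eq_cov : curvature D X Y Z =
    cov D X (cov D Y Z) - cov D Y (cov D X Z) - cov D (mlieBracket I X Y) Z :=
  rfl

theorem curvature_antisymm_left : curvature D X Y Z = -curvature D Y X Z := by
  funext p
  simp only [curvature, Pi.neg_apply]
  rw [mlieBracket_swap (V := X), Pi.neg_apply, map_neg]
  abel

/-- Apply [X,Y] = XY − YX to the function g(Z,W) and expand with metricity; the mixed first-order
terms cancel. -/
theorem IsMetric.curvature_skew [T2Space M] (hs : PreservesSmooth D) (hm : IsMetric g D)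
    (hX : IsSmoothField X) (hY : IsSmoothField Y) (hZ : IsSmoothField Z) (hW : IsSmoothField W) :
    innerFn g (curvature D X Y Z) W = -innerFn g (curvature D X Y W) Z := by
  have key := lieDer_mlieBracket hX hY (hZ.innerFn (g := g) hW)
  rw [hm hY hZ hW, hm hX hZ hW, hm (hX.mlieBracket hY) hZ hW,
    lieDer_add ((hs hY hZ).innerFn hW) (hZ.innerFn (hs hY hW)),
    lieDer_add ((hs hX hZ).innerFn hW) (hZ.innerFn (hs hX hW)),
    hm hX (hs hY hZ) hW, hm hY (hs hX hZ) hW, hm hX hZ (hs hY hW), hm hY hZ (hs hX hW)] at key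
  simp only [curvature_eq_cov, innerFn_sub_left]
  rw [innerFn_comm (X := cov D X (cov D Y W)), innerFn_comm (X := cov D Y (cov D X W)),
    innerFn_comm (X := cov D (mlieBracket I X Y) W)]
  linear_combination -key

theorem IsParallel.curvature {P : AlmostProductStructure g} (hs : PreservesSmooth D)
    (hP : IsParallel P D) (hX : IsSmoothField X) (hY : IsSmoothField Y) (hZ : IsSmoothField Z) :
    curvature D X Y (P.onField Z) = P.onField (curvature D X Y Z) := by
  simp only [curvature_eq_cov]
  rw [hP hY hZ, hP hX hZ, hP hX (hs hY hZ), hP hY (hs hX hZ), hP (hX.mlieBracket hY) hZ]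
  funext p
  simp [AlmostProductStructure.onField]

/-- The exterior derivative of the 1-form `α` on the vector fields `X`, `Y`. -/
def extDeriv (α : ∀ x : M, TangentSpace I x →L[ℝ] ℝ) (X Y : ∀ x : M, TangentSpace I x) : M → ℝ :=
  lieDer X (fun q => α q (Y q)) - lieDer Y (fun q => α q (X q))
    - fun q => α q (mlieBracket I X Y q)

/-- `α` maps smooth fields to smooth functions. -/
def IsSmoothForm (α : ∀ x : M, TangentSpace I x →L[ℝ] ℝ) : Prop :=
  ∀ {X : ∀ x : M, TangentSpace I x}, IsSmoothField X → ContMDiff I 𝓘(ℝ) ∞ (fun q => α q (X q))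

/-- The first Bianchi identity of a connection with parallel `P` and torsion
`α ∧ P + β ∧ Id`. -/
theorem curvature_bianchi {P : AlmostProductStructure g} (hs : PreservesSmooth D)
    (hP : IsParallel P D) {α β : ∀ x : M, TangentSpace I x →L[ℝ] ℝ} (hα : IsSmoothForm α)
    (hβ : IsSmoothForm β)
    (hT : ∀ {X Y : ∀ x : M, TangentSpace I x}, IsSmoothField X → IsSmoothField Y →
      cov D X Y = cov D Y X + mlieBracket I X Y + ((fun q => α q (X q)) • P.onField Y
        - (fun q => α q (Y q)) • P.onField X + (fun q => β q (X q)) • Y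
        - (fun q => β q (Y q)) • X))
    (hX : IsSmoothField X) (hY : IsSmoothField Y) (hZ : IsSmoothField Z) :
    curvature D X Y Z + curvature D Y Z X + curvature D Z X Y =
      extDeriv α X Y • P.onField Z + extDeriv α Y Z • P.onField X + extDeriv α Z X • P.onField Y
        + extDeriv β X Y • Z + extDeriv β Y Z • X + extDeriv β Z X • Y := by
  -- The cyclic sum regroups into terms ∇_X(∇_Y Z − ∇_Z Y) − ∇_{[Y,Z]}X. The torsion formula is used
  -- for the inner difference and for the pair X, [Y,Z]; differentiating the coefficients α, β
  -- produces the pieces of dα and dβ.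
  have expand : ∀ {X Y Z : ∀ x : M, TangentSpace I x}, IsSmoothField X → IsSmoothField Y →
      IsSmoothField Z → cov D X (cov D Y Z) - cov D X (cov D Z Y) - cov D (mlieBracket I Y Z) X =
      mlieBracket I X (mlieBracket I Y Z) +
      ((fun q => α q (X q)) • P.onField (mlieBracket I Y Z)
        - (fun q => α q (mlieBracket I Y Z q)) • P.onField X + (fun q => β q (X q)) • mlieBracket I Y Z
        - (fun q => β q (mlieBracket I Y Z q)) • X) +
      ((fun q => α q (Y q)) • P.onField (cov D X Z) + lieDer X (fun q => α q (Y q)) • P.onField Z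
      - ((fun q => α q (Z q)) • P.onField (cov D X Y) + lieDer X (fun q => α q (Z q)) • P.onField Y)
      + ((fun q => β q (Y q)) • cov D X Z + lieDer X (fun q => β q (Y q)) • Z)
      - ((fun q => β q (Z q)) • cov D X Y + lieDer X (fun q => β q (Z q)) • Y)) := by
    intro X Y Z hX hY hZ
    have s1 := (hα hY).smul_section (hZ.onField P)
    have s2 := (hα hZ).smul_section (hY.onField P)
    have s3 := (hβ hY).smul_section hZ
    have s4 := (hβ hZ).smul_section hY
    have hYZ := hY.mlieBracket hZ
    rw [hT hY hZ, cov_add ((hs hZ hY).add_section hYZ)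
        (((s1.sub_section s2).add_section s3).sub_section s4),
      cov_add (hs hZ hY) hYZ, cov_sub ((s1.sub_section s2).add_section s3) s4,
      cov_add (s1.sub_section s2) s3, cov_sub s1 s2, cov_smul (hα hY) (hZ.onField P),
      cov_smul (hα hZ) (hY.onField P), cov_smul (hβ hY) hZ, cov_smul (hβ hZ) hY, hP hX hZ, hP hX hY,
      hT hX hYZ]
    abel
  have e1 := expand hX hY hZ
  have e2 := expand hY hZ hX
  have e3 := expand hZ hX hY
  have j := mlieBracket_jacobi hX hY hZ
  rw [mlieBracket_swap (V := mlieBracket I X Y), mlieBracket_swap (V := X) (W := Z)] at j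
  have tXY := hT hX hY
  have tYZ := hT hY hZ
  have tZX := hT hZ hX
  funext p
  replace e1 := congrFun e1 p
  replace e2 := congrFun e2 p
  replace e3 := congrFun e3 p
  have j2 : mlieBracket I X (mlieBracket I Y Z) p + mlieBracket I Z (mlieBracket I X Y) p
      + mlieBracket I Y (mlieBracket I Z X) p = 0 := by
    have := congrFun j p
    simp only [mlieBracket_neg (hZ.mlieBracket hX), Pi.add_apply, Pi.neg_apply] at this
    rw [this]
    abel
  replace tXY := congrFun tXY p
  replace tYZ := congrFun tYZ p
  replace tZX := congrFun tZX p
  have pXY := congrArg (P p) tXY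
  have pYZ := congrArg (P p) tYZ
  have pZX := congrArg (P p) tZX
  simp only [AlmostProductStructure.onField, Pi.add_apply, Pi.sub_apply, Pi.smul_apply',
    map_add, map_sub, map_smul, P.involutive] at *
  simp only [curvature_eq_cov, extDeriv, Pi.sub_apply]
  -- The undifferentiated terms α(X)P(∇_Y Z − ∇_Z Y − [Y,Z]), and likewise with β, are torsion
  -- again. After substitution the terms quadratic in α and β cancel in the cyclic sum, using P² =
  -- 1.
  linear_combination (norm := module) e1 + e2 + e3 + j2 - α p (X p) • pYZ
    - α p (Y p) • pZX - α p (Z p) • pXY - β p (X p) • tYZ - β p (Y p) • tZX - β p (Z p) • tXY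

end Cov

end

section

/-! ### The eigendistributions of `P` -/

/-- The projection (1 + εT)/2 onto the ε-eigenspace has trace dim V / 2, which is its rank. So the
eigenspace has dimension at least 2 and meets the kernel of any functional nontrivially. -/
theorem exists_eigenvector_of_trace_eq_zero {V : Type*} [AddCommGroup V] [Module ℝ V]
    [FiniteDimensional ℝ V] {T : V →ₗ[ℝ] V} (hT : ∀ v, T (T v) = v)
    (htr : LinearMap.trace ℝ V T = 0) (hV : 4 ≤ Module.finrank ℝ V) (φ : V →ₗ[ℝ] ℝ) {ε : ℝ}
    (hε : ε * ε = 1) : ∃ z, z ≠ 0 ∧ T z = ε • z ∧ φ z = 0 := by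
  set f : V →ₗ[ℝ] V := (1 / 2 : ℝ) • (LinearMap.id + ε • T) with hf
  have hTf : ∀ v, T (f v) = ε • f v := by
    intro v
    simp only [hf, LinearMap.smul_apply, LinearMap.add_apply, LinearMap.id_apply, map_smul, map_add,
      hT]
    linear_combination (norm := module) (-(1 / 2) * hε) • T v
  have hproj : LinearMap.IsProj (LinearMap.range f) f := by
    refine ⟨fun v => ⟨v, rfl⟩, ?_⟩
    rintro _ ⟨v, rfl⟩
    have h : f (f v) = (1 / 2 : ℝ) • (f v + ε • T (f v)) := rfl
    rw [h, hTf]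
    linear_combination (norm := module) ((1 / 2) * hε) • f v
  have hrank : (Module.finrank ℝ (LinearMap.range f) : ℝ) = 1 / 2 * Module.finrank ℝ V := by
    rw [← hproj.trace, hf]
    simp [htr]
  have hlt : Module.finrank ℝ ℝ < Module.finrank ℝ (LinearMap.range f) := by
    have : (4 : ℝ) ≤ Module.finrank ℝ V := by exact_mod_cast hV
    rw [Module.finrank_self]
    have : (1 : ℝ) < Module.finrank ℝ (LinearMap.range f) := by linarith
    exact_mod_cast this
  have hker := LinearMap.ker_ne_bot_of_finrank_lt (f := φ ∘ₗ (LinearMap.range f).subtype) hlt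
  obtain ⟨⟨z, v, rfl⟩, hz, hz0⟩ := Submodule.exists_mem_ne_zero_of_ne_bot hker
  exact ⟨f v, fun h => hz0 (Subtype.ext h), hTf v, hz⟩

variable {g : Metric I M} {X Y Z W U : ∀ x : M, TangentSpace I x} {f : M → ℝ} {ε : ℝ}
  {P : AlmostProductStructure g} {D : LinearConnection I M}

theorem onField_add : P.onField (X + Y) = P.onField X + P.onField Y := by
  funext p; simp [AlmostProductStructure.onField]

theorem onField_sub : P.onField (X - Y) = P.onField X - P.onField Y := by
  funext p; simp [AlmostProductStructure.onField]

theorem onField_const_smul {c : ℝ} : P.onField (c • X) = c • P.onField X := by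
  funext p; simp [AlmostProductStructure.onField]

theorem onField_onField : P.onField (P.onField X) = X :=
  funext fun p => P.involutive p _

theorem AlmostProductStructure.inner_swap (P : AlmostProductStructure g) (p : M)
    (u v : TangentSpace I p) : g.inner p (P p u) v = g.inner p u (P p v) := by
  rw [← P.isometry p u (P p v), P.involutive]

/-- The projection of a vector field to the eigendistribution of `P` for the eigenvalue `ε`. -/
def AlmostProductStructure.proj (P : AlmostProductStructure g) (ε : ℝ)
    (X : ∀ x : M, TangentSpace I x) : ∀ x : M, TangentSpace I x :=
  (1 / 2 : ℝ) • (X + ε • P.onField X)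

theorem IsSmoothField.proj (hX : IsSmoothField X) (P : AlmostProductStructure g) (ε : ℝ) :
    IsSmoothField (P.proj ε X) :=
  (hX.add_section (hX.onField P).const_smul_section).const_smul_section

theorem onField_proj (hε : ε * ε = 1) : P.onField (P.proj ε X) = ε • P.proj ε X := by
  simp only [AlmostProductStructure.proj, onField_const_smul, onField_add, onField_onField]
  linear_combination (norm := module) (-(1 / 2) * hε) • P.onField X

theorem proj_eq_zero (hε : ε * ε = 1) (hX : P.onField X = ε • X) : P.proj (-ε) X = 0 := by
  simp only [AlmostProductStructure.proj, hX]
  linear_combination (norm := module) (-(1 / 2) * hε) • X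

theorem proj_sub : P.proj ε (X - Y) = P.proj ε X - P.proj ε Y := by
  simp only [AlmostProductStructure.proj, onField_sub]
  module

theorem proj_add_proj : P.proj ε X + P.proj (-ε) X = X := by
  simp only [AlmostProductStructure.proj]
  module

theorem innerFn_onField_left : innerFn g (P.onField X) Y = innerFn g X (P.onField Y) :=
  funext fun p => P.inner_swap p _ _

theorem innerFn_const_smul_left {c : ℝ} : innerFn g (c • X) Z = c • innerFn g X Z := by
  funext p; simp [innerFn]

theorem innerFn_const_smul_right {c : ℝ} : innerFn g X (c • Z) = c • innerFn g X Z := by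
  funext p; simp [innerFn]

theorem innerFn_proj_left (hε : ε * ε = 1) (hY : P.onField Y = ε • Y) :
    innerFn g (P.proj ε X) Y = innerFn g X Y := by
  simp only [AlmostProductStructure.proj, innerFn_const_smul_left, innerFn_add_left,
    innerFn_onField_left, hY, innerFn_const_smul_right]
  linear_combination (norm := module) ((1 / 2) * hε) • innerFn g X Y

theorem innerFn_eq_zero (hε : ε * ε = 1) (hX : P.onField X = ε • X)
    (hY : P.onField Y = (-ε) • Y) : innerFn g X Y = 0 := by
  have h := innerFn_onField_left (P := P) (X := X) (Y := Y)
  rw [hX, hY, innerFn_const_smul_left, innerFn_const_smul_right] at h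
  have h2 := congrArg (fun k => (ε / 2) • k) h
  linear_combination (norm := module) h2 - hε • innerFn g X Y

/-- Projecting a smooth extension of an eigenvector makes it an eigenfield everywhere without
changing its value at p. With w = 0 the orthogonality is void. -/
theorem exists_eigenfield [T2Space M] (P : AlmostProductStructure g)
    (hE : 4 ≤ Module.finrank ℝ E) (hε : ε * ε = 1) (p : M) (w : TangentSpace I p) :
    ∃ Z : ∀ x : M, TangentSpace I x, IsSmoothField Z ∧ P.onField Z = ε • Z ∧ Z p ≠ 0 ∧
      g.inner p w (Z p) = 0 := by
  obtain ⟨z, hz0, hz, hwz⟩ := exists_eigenvector_of_trace_eq_zero (T := (P p).toLinearMap)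
    (P.involutive p) (P.trace_eq_zero p) hE (g.inner p w).toLinearMap hε
  obtain ⟨Z, hZ, rfl⟩ := exists_isSmoothField p z
  have hp : P.proj ε Z p = Z p := by
    have hz' : P p (Z p) = ε • Z p := hz
    simp only [AlmostProductStructure.proj, AlmostProductStructure.onField, Pi.smul_apply,
      Pi.add_apply, hz']
    linear_combination (norm := module) ((1 / 2) * hε) • Z p
  exact ⟨P.proj ε Z, hZ.proj P ε, onField_proj hε, by rwa [hp], by rw [hp]; exact hwz⟩

/-! ### The Levi-Civita connection -/

theorem IsLeviCivita.preservesSmooth (hD : IsLeviCivita g D) : PreservesSmooth D :=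
  fun hX hY => isSmoothField_cov hD.smooth hX hY

theorem IsLeviCivita.isMetric (hD : IsLeviCivita g D) : IsMetric g D := by
  intro X Y Z _ hY hZ
  funext p
  exact hD.metric ⟨Y, hY⟩ ⟨Z, hZ⟩ p (X p)

theorem IsLeviCivita.mlieBracket_eq (hD : IsLeviCivita g D) (hX : IsSmoothField X)
    (hY : IsSmoothField Y) : mlieBracket I X Y = cov D X Y - cov D Y X := by
  funext p
  exact (D.torsion_eq_zero_iff.1 hD.torsion_eq_zero (hX.mdiffAt p) (hY.mdiffAt p)).symm

/-! ### The class `W₁` -/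

theorem Metric.eq_of_inner_eq (g : Metric I M) {p : M} {u v : TangentSpace I p}
    (h : ∀ w, g.inner p u w = g.inner p v w) : u = v := by
  by_contra huv
  have := g.pos p (u - v) (sub_ne_zero.2 huv)
  simp [h] at this

theorem leeForm_onField_apply (p : M) (u : TangentSpace I p) :
    leeForm P D p (P p u) = g.inner p (P p (leeVector P D p)) u := by
  rw [P.inner_swap]; rfl

variable {n : ℕ}

theorem IsW1Manifold.nablaP_eq (hW : IsW1Manifold n P D) (p : M) (x y : TangentSpace I p) :
    nablaP P D p y x = (1 / (2 * (n : ℝ))) • (g.inner p x y • leeVector P D p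
      - g.inner p x (P p y) • P p (leeVector P D p)
      + leeForm P D p y • x - leeForm P D p (P p y) • P p x) := by
  refine Metric.eq_of_inner_eq g fun z => ?_
  have h := hW p x y z
  rw [tensorF] at h
  rw [h, leeForm_onField_apply p z, ← P.inner_swap p x z]
  simp only [map_smul, map_add, map_sub, add_apply, sub_apply, smul_apply,
    smul_eq_mul, inner_leeVector]
  ring

/-- The 1-form `θ ∘ P`. -/
def leeFormP (P : AlmostProductStructure g) (D : LinearConnection I M) (x : M) :
    TangentSpace I x →L[ℝ] ℝ :=
  (leeForm P D x).comp (P x)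

theorem IsW1Manifold.cov_onField (hW : IsW1Manifold n P D) (hY : IsSmoothField Y) :
    cov D X (P.onField Y) = P.onField (cov D X Y) + (1 / (2 * (n : ℝ))) •
      (innerFn g X Y • leeVector P D - innerFn g X (P.onField Y) • P.onField (leeVector P D)
        + (fun q => leeForm P D q (Y q)) • X
        - (fun q => leeFormP P D q (Y q)) • P.onField X) := by
  funext p
  have h1 := nablaP_apply P D (hY.mdiffAt p) (X p)
  rw [hW.nablaP_eq] at h1
  exact (add_eq_of_eq_sub' h1).symm

/-- The definition of Ω uses an unrelated basis at each point, so smoothness is read off from the W₁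
identity. For an ε-eigenfield Z the θ(Z) terms cancel and 2n(∇_Z P)Z = g(Z,Z)(Ω − εPΩ). Dividing by
g(Z,Z) near a point where Z ≠ 0 and averaging over ε = ±1 gives Ω. -/
theorem IsW1Manifold.isSmoothField_leeVector [T2Space M] (hW : IsW1Manifold n P D) (hn : n ≠ 0)
    (hD : IsLeviCivita g D) (hE : 4 ≤ Module.finrank ℝ E) : IsSmoothField (leeVector P D) := by
  have key : ∀ ε : ℝ, ε * ε = 1 → IsSmoothField (leeVector P D - ε • P.onField (leeVector P D)) := by
    intro ε hε p
    obtain ⟨Z, hZ, hPZ, hZp, -⟩ := exists_eigenfield P hE hε p 0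
    have hcov := hW.cov_onField (X := Z) hZ
    have hZZ := hZ.innerFn (g := g) hZ
    have hpos : innerFn g Z Z p ≠ 0 := (g.pos p (Z p) hZp).ne'
    have hsm : IsSmoothField ((2 * (n : ℝ)) • (cov D Z (P.onField Z) - P.onField (cov D Z Z))) :=
      ((hD.preservesSmooth hZ (hZ.onField P)).sub_section
        ((hD.preservesSmooth hZ hZ).onField P)).const_smul_section
    have hinv : ContMDiffAt I 𝓘(ℝ) ∞ (fun q => (innerFn g Z Z q)⁻¹) p := (hZZ p).inv₀ hpos
    refine (hinv.smul_section (hsm p)).congr_of_eventuallyEq ?_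
    filter_upwards [hZZ.continuous.continuousAt.eventually_ne hpos] with q hq
    have hn' : (n : ℝ) ≠ 0 := by exact_mod_cast hn
    have hPq : P q (Z q) = ε • Z q := congrFun hPZ q
    congr 1
    rw [hcov]
    simp only [Pi.smul_apply', Pi.smul_apply, Pi.sub_apply, Pi.add_apply, innerFn, leeFormP,
      AlmostProductStructure.onField, ContinuousLinearMap.comp_apply, hPq, map_smul, smul_eq_mul]
    rw [add_sub_cancel_left, smul_smul (2 * (n : ℝ)), mul_one_div_cancel (by positivity), one_smul]
    rw [innerFn] at hq
    have e : g.inner q (Z q) (Z q) • leeVector P D q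
        - (ε * g.inner q (Z q) (Z q)) • P q (leeVector P D q)
        + leeForm P D q (Z q) • Z q - (ε * leeForm P D q (Z q)) • ε • Z q
        = g.inner q (Z q) (Z q) • (leeVector P D q - ε • P q (leeVector P D q)) := by
      linear_combination (norm := module) (-(leeForm P D q (Z q)) * hε) • Z q
    rw [e, smul_smul, inv_mul_cancel₀ hq, one_smul]
  have h := ((key 1 (by norm_num)).add_section (key (-1) (by norm_num))).const_smul_section
    (a := (1 / 2 : ℝ))
  have e : leeVector P D = (1 / 2 : ℝ) • (leeVector P D - (1 : ℝ) • P.onField (leeVector P D)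
      + (leeVector P D - (-1 : ℝ) • P.onField (leeVector P D))) := by module
  rw [e]
  exact h

/-! ### Conformal foliations by the eigendistributions -/

/-- Integrability: since ∇ is torsion-free, ε[X,Y] − P[X,Y] = (∇_X P)Y − (∇_Y P)X. On the
eigendistribution the W₁ formula makes (∇_X P)Y symmetric, because its θ terms cancel by ε² = 1. -/
theorem IsW1Manifold.mlieBracket_mem (hW : IsW1Manifold n P D) (hD : IsLeviCivita g D)
    (hε : ε * ε = 1) (hX : IsSmoothField X) (hY : IsSmoothField Y) (hPX : P.onField X = ε • X)
    (hPY : P.onField Y = ε • Y) :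
    P.onField (mlieBracket I X Y) = ε • mlieBracket I X Y := by
  have h1 := hW.cov_onField (X := X) hY
  have h2 := hW.cov_onField (X := Y) hX
  rw [hPY, cov_const_smul hY] at h1
  rw [hPX, cov_const_smul hX] at h2
  rw [hD.mlieBracket_eq hX hY, onField_sub]
  funext p
  replace h1 := congrFun h1 p
  replace h2 := congrFun h2 p
  have hXp : P p (X p) = ε • X p := congrFun hPX p
  have hYp : P p (Y p) = ε • Y p := congrFun hPY p
  simp only [Pi.smul_apply', Pi.smul_apply, Pi.sub_apply, Pi.add_apply, innerFn, leeFormP,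
    AlmostProductStructure.onField, ContinuousLinearMap.comp_apply, hXp, hYp, map_smul,
    smul_eq_mul] at h1 h2 ⊢
  rw [g.symm p (Y p) (X p)] at h2
  linear_combination (norm := module) h2 - h1 + (1 / (2 * (n : ℝ)) * leeForm P D p (Y p)) • hε • X p
    - (1 / (2 * (n : ℝ)) * leeForm P D p (X p)) • hε • Y p

/-- This says that V_{−ε} is totally umbilical. As X and W have opposite eigenvalues, g((∇_Z P)X, W)
= 2ε g(∇_Z X, W), while the W₁ formula evaluates the left side as θ(X)g(Z,W)/n. -/
theorem IsW1Manifold.innerFn_cov (hW : IsW1Manifold n P D) (hε : ε * ε = 1)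
    (hX : IsSmoothField X) (hPX : P.onField X = ε • X) (hPZ : P.onField Z = (-ε) • Z) (hPW : P.onField W = (-ε) • W) :
    innerFn g (cov D Z X) W =
      (ε / (2 * (n : ℝ))) • ((fun q => leeForm P D q (X q)) * innerFn g Z W) := by
  have h1 := hW.cov_onField (X := Z) hX
  rw [hPX, cov_const_smul hX] at h1
  funext p
  replace h1 := congrArg (fun v => g.inner p v (W p)) (congrFun h1 p)
  have hXp : P p (X p) = ε • X p := congrFun hPX p
  have hZp : P p (Z p) = (-ε) • Z p := congrFun hPZ p
  have hWp : P p (W p) = (-ε) • W p := congrFun hPW p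
  have hZX : g.inner p (Z p) (X p) = 0 := by
    rw [g.symm]
    exact congrFun (innerFn_eq_zero hε hPX hPZ) p
  simp only [Pi.smul_apply', Pi.smul_apply, Pi.sub_apply, Pi.add_apply, Pi.mul_apply, innerFn,
    leeFormP, AlmostProductStructure.onField, ContinuousLinearMap.comp_apply, hXp, hZp, hWp,
    P.inner_swap, map_smul, map_add, map_sub, add_apply, sub_apply, smul_apply, smul_eq_mul,
    hZX] at h1 ⊢
  linear_combination ε / 2 * h1 + (ε / (4 * n) * leeForm P D p (X p) * g.inner p (Z p) (W p)
    - g.inner p (cov D Z X p) (W p)) * hε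

/-- The Lee form is closed along the leaves of the eigendistributions of `P`. -/
theorem IsW1Manifold.extDeriv_leeForm_eq_zero [T2Space M] (hW : IsW1Manifold n P D) (hn : n ≠ 0)
    (hD : IsLeviCivita g D) (hE : 4 ≤ Module.finrank ℝ E)
    (hε : ε * ε = 1) (hX : IsSmoothField X) (hY : IsSmoothField Y) (hPX : P.onField X = ε • X)
    (hPY : P.onField Y = ε • Y) : extDeriv (leeForm P D) X Y = 0 := by
  funext p
  -- N is the Bott connection on V_{−ε}, differentiating along V_ε.
  set N : (∀ x : M, TangentSpace I x) → (∀ x : M, TangentSpace I x) →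
    (∀ x : M, TangentSpace I x) := fun X Z => P.proj (-ε) (mlieBracket I X Z)
  have hε' : -ε * -ε = 1 := by linarith
  have sN : ∀ {X Z : ∀ x : M, TangentSpace I x}, IsSmoothField X → IsSmoothField Z →
    IsSmoothField (N X Z) := fun hX hZ => (hX.mlieBracket hZ).proj P _
  have mN : ∀ X Z : ∀ x : M, TangentSpace I x, P.onField (N X Z) = (-ε) • N X Z :=
    fun _ _ => onField_proj hε'
  -- The Bott connection preserves g up to the conformal factor (ε/n)θ(X), the sum of two umbilicity
  -- terms ε/(2n)·θ(X).
  have der : ∀ {X Z W : ∀ x : M, TangentSpace I x}, IsSmoothField X → IsSmoothField Z →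
      IsSmoothField W → P.onField X = ε • X → P.onField Z = (-ε) • Z → P.onField W = (-ε) • W →
      lieDer X (innerFn g Z W) = innerFn g (N X Z) W + innerFn g Z (N X W)
        + (ε / n) • ((fun q => leeForm P D q (X q)) * innerFn g Z W) := by
    intro X Z W hX hZ hW' hPX hPZ hPW
    have e1 := hW.innerFn_cov hε hX hPX hPZ hPW
    have e2 := hW.innerFn_cov hε hX hPX hPW hPZ
    rw [innerFn_comm (X := W) (Y := Z)] at e2
    rw [hD.isMetric hX hZ hW', innerFn_comm (X := Z) (Y := N X W), innerFn_proj_left hε' hPZ,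
      innerFn_proj_left hε' hPW, hD.mlieBracket_eq hX hZ, hD.mlieBracket_eq hX hW',
      innerFn_sub_left, innerFn_sub_left, e1, e2, innerFn_comm (X := Z) (Y := cov D X W)]
    have : ε / (n : ℝ) = ε / (2 * (n : ℝ)) + ε / (2 * (n : ℝ)) := by field_simp; ring
    rw [this]
    module
  -- The inner projection may be dropped: the discarded part of [Y,Z] lies in V_ε, and by
  -- integrability so does its bracket with X. The Jacobi identity then makes N flat.
  have flat : ∀ {X Y Z : ∀ x : M, TangentSpace I x}, IsSmoothField X → IsSmoothField Y →
      IsSmoothField Z → P.onField X = ε • X → P.onField Y = ε • Y →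
      N X (N Y Z) = P.proj (-ε) (mlieBracket I X (mlieBracket I Y Z)) := by
    intro X Y Z hX hY hZ hPX hPY
    have hYZ := hY.mlieBracket hZ
    have h := mlieBracket_add (X := X) (hYZ.proj P ε) (hYZ.proj P (-ε))
    rw [proj_add_proj] at h
    have h0 := proj_eq_zero hε
      (hW.mlieBracket_mem hD hε hX (hYZ.proj P ε) hPX (onField_proj (P := P) hε))
    change P.proj (-ε) (mlieBracket I X (P.proj (-ε) (mlieBracket I Y Z))) = _
    rw [← sub_eq_iff_eq_add'.2 h, proj_sub, h0, sub_zero]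
  obtain ⟨Z, hZ, hPZ, hZp, -⟩ : ∃ Z : ∀ x : M, TangentSpace I x, IsSmoothField Z ∧
      P.onField Z = (-ε) • Z ∧ Z p ≠ 0 ∧ g.inner p 0 (Z p) = 0 := exists_eigenfield P hE hε' p 0
  have hΩ := hW.isSmoothField_leeVector hn hD hE
  have hθX : ContMDiff I 𝓘(ℝ) ∞ (fun q => leeForm P D q (X q)) := hΩ.innerFn hX
  have hθY : ContMDiff I 𝓘(ℝ) ∞ (fun q => leeForm P D q (Y q)) := hΩ.innerFn hY
  have hZZ := hZ.innerFn (g := g) hZ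
  have hXY := hX.mlieBracket hY
  have hPXY := hW.mlieBracket_mem hD hε hX hY hPX hPY
  have hNX := sN hX hZ
  have hNY := sN hY hZ
  have hN1 : N X (N Y Z) - N Y (N X Z) = N (mlieBracket I X Y) Z := by
    rw [flat hX hY hZ hPX hPY, flat hY hX hZ hPY hPX, ← proj_sub, mlieBracket_jacobi hX hY hZ,
      add_sub_cancel_right]
  have hN2 : innerFn g (N X (N Y Z)) Z - innerFn g (N Y (N X Z)) Z =
      innerFn g (N (mlieBracket I X Y) Z) Z := by
    rw [← innerFn_sub_left, hN1]
  -- Compute [X,Y] g(Z,Z) in two ways with `der`. Flatness cancels the second-order terms, symmetry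
  -- cancels the products θ(X)θ(Y), and (ε/n) dθ(X,Y) g(Z,Z) = 0 remains.
  have key := lieDer_mlieBracket hX hY hZZ
  rw [der hXY hZ hZ hPXY hPZ hPZ, der hX hZ hZ hPX hPZ hPZ, der hY hZ hZ hPY hPZ hPZ,
    innerFn_comm (X := Z) (Y := N X Z), innerFn_comm (X := Z) (Y := N Y Z),
    innerFn_comm (X := Z) (Y := N (mlieBracket I X Y) Z),
    lieDer_add ((hNY.innerFn hZ).add (hNY.innerFn hZ)) (contMDiff_real_smul _ (hθY.mul hZZ)),
    lieDer_add ((hNX.innerFn hZ).add (hNX.innerFn hZ)) (contMDiff_real_smul _ (hθX.mul hZZ)),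
    lieDer_add (hNY.innerFn hZ) (hNY.innerFn hZ), lieDer_add (hNX.innerFn hZ) (hNX.innerFn hZ),
    lieDer_smul _ (hθY.mul hZZ), lieDer_smul _ (hθX.mul hZZ),
    lieDer_mul hθY hZZ, lieDer_mul hθX hZZ, der hX hZ hZ hPX hPZ hPZ, der hY hZ hZ hPY hPZ hPZ,
    der hX hNY hZ hPX (mN Y Z) hPZ, der hY hNX hZ hPY (mN X Z) hPZ,
    innerFn_comm (X := N X Z) (Y := N Y Z), innerFn_comm (X := Z) (Y := N X Z),
    innerFn_comm (X := Z) (Y := N Y Z)] at key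
  replace key := congrFun key p
  replace hN2 := congrFun hN2 p
  have hpos : innerFn g Z Z p ≠ 0 := (g.pos p (Z p) hZp).ne'
  have hε0 : ε ≠ 0 := by rintro rfl; simp at hε
  have hn' : (n : ℝ) ≠ 0 := by exact_mod_cast hn
  have hk : ε / n * innerFn g Z Z p ≠ 0 := mul_ne_zero (div_ne_zero hε0 hn') hpos
  refine (mul_eq_zero.1 ?_).resolve_left hk
  simp only [extDeriv, Pi.add_apply, Pi.sub_apply, Pi.smul_apply, Pi.mul_apply, smul_eq_mul]
    at key hN2 ⊢
  linear_combination -2 * hN2 - key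

end

section

variable {g : Metric I M} {X Y Z W U : ∀ x : M, TangentSpace I x} {f : M → ℝ} {ε : ℝ}
  {P : AlmostProductStructure g} {D : LinearConnection I M} {n : ℕ} {a b : ℝ}

/-! ### Linear combinations of `θ` and `θ ∘ P` -/

/-- The 1-form `a θ ∘ P + b θ`. -/
def combForm (P : AlmostProductStructure g) (D : LinearConnection I M) (a b : ℝ) (x : M) :
    TangentSpace I x →L[ℝ] ℝ :=
  a • leeFormP P D x + b • leeForm P D x

/-- The vector field `a P Ω + b Ω`, dual to `combForm P D a b`. -/
def combField (P : AlmostProductStructure g) (D : LinearConnection I M) (a b : ℝ) :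
    ∀ x : M, TangentSpace I x :=
  a • P.onField (leeVector P D) + b • leeVector P D

theorem innerFn_combField : innerFn g (combField P D a b) X = fun q => combForm P D a b q (X q) := by
  funext q
  simp [innerFn, combField, combForm, leeFormP, leeForm_onField_apply, inner_leeVector,
    AlmostProductStructure.onField]

theorem isSmoothField_combField (hΩ : IsSmoothField (leeVector P D)) (a b : ℝ) :
    IsSmoothField (combField P D a b) :=
  (hΩ.onField P).const_smul_section.add_section hΩ.const_smul_section

theorem isSmoothForm_combForm (hΩ : IsSmoothField (leeVector P D)) (a b : ℝ) :
    IsSmoothForm (combForm P D a b) := by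
  intro X hX
  rw [← innerFn_combField]
  exact (isSmoothField_combField hΩ a b).innerFn hX

theorem extDeriv_antisymm {α : ∀ x : M, TangentSpace I x →L[ℝ] ℝ} (X Y : ∀ x : M, TangentSpace I x) :
    extDeriv α X Y = -extDeriv α Y X := by
  funext p
  simp only [extDeriv, Pi.sub_apply, Pi.neg_apply]
  rw [mlieBracket_swap (V := X), Pi.neg_apply, map_neg]
  ring

theorem extDeriv_add_right {α : ∀ x : M, TangentSpace I x →L[ℝ] ℝ} (hα : IsSmoothForm α)
    (hY : IsSmoothField Y) (hZ : IsSmoothField Z) :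
    extDeriv α X (Y + Z) = extDeriv α X Y + extDeriv α X Z := by
  have h1 : (fun q => α q ((Y + Z) q)) = (fun q => α q (Y q)) + fun q => α q (Z q) := by
    funext q; simp
  have h2 : ∀ f : M → ℝ, lieDer (Y + Z) f = lieDer Y f + lieDer Z f := by
    intro f; funext q; simp [lieDer]
  simp only [extDeriv]
  rw [h1, lieDer_add (hα hY) (hα hZ), mlieBracket_add hY hZ, h2]
  funext p
  simp only [Pi.sub_apply, Pi.add_apply, map_add]
  ring

theorem extDeriv_add_left {α : ∀ x : M, TangentSpace I x →L[ℝ] ℝ} (hα : IsSmoothForm α)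
    (hY : IsSmoothField Y) (hZ : IsSmoothField Z) :
    extDeriv α (Y + Z) X = extDeriv α Y X + extDeriv α Z X := by
  rw [extDeriv_antisymm, extDeriv_add_right hα hY hZ, extDeriv_antisymm Y X, extDeriv_antisymm Z X]
  abel

theorem isSmoothForm_leeForm (hΩ : IsSmoothField (leeVector P D)) : IsSmoothForm (leeForm P D) :=
  fun hX => hΩ.innerFn hX

theorem isSmoothForm_leeFormP (hΩ : IsSmoothField (leeVector P D)) : IsSmoothForm (leeFormP P D) :=
  fun hX => hΩ.innerFn (hX.onField P)

theorem lieDer_combForm (hΩ : IsSmoothField (leeVector P D)) (hY : IsSmoothField Y) :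
    lieDer X (fun q => combForm P D a b q (Y q)) = a • lieDer X (fun q => leeFormP P D q (Y q))
      + b • lieDer X (fun q => leeForm P D q (Y q)) := by
  have e : (fun q => combForm P D a b q (Y q)) =
      a • (fun q => leeFormP P D q (Y q)) + b • (fun q => leeForm P D q (Y q)) := by
    funext q; simp [combForm]
  rw [e, lieDer_add (contMDiff_real_smul _ (isSmoothForm_leeFormP hΩ hY))
    (contMDiff_real_smul _ (isSmoothForm_leeForm hΩ hY)),
    lieDer_smul _ (isSmoothForm_leeFormP hΩ hY), lieDer_smul _ (isSmoothForm_leeForm hΩ hY)]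

theorem extDeriv_combForm (hΩ : IsSmoothField (leeVector P D)) (hX : IsSmoothField X)
    (hY : IsSmoothField Y) : extDeriv (combForm P D a b) X Y =
      a • extDeriv (leeFormP P D) X Y + b • extDeriv (leeForm P D) X Y := by
  simp only [extDeriv]
  rw [lieDer_combForm hΩ hX, lieDer_combForm hΩ hY]
  funext p
  simp [combForm]
  ring

/-- Differentiating θ∘P produces the extra term θ((∇_X P)Y). By the W₁ formula it is symmetric in X
and Y, so it drops out of the antisymmetrization. -/
theorem IsW1Manifold.extDeriv_combForm_eq_nablaForm (hW : IsW1Manifold n P D)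
    (hD : IsLeviCivita g D) (hΩ : IsSmoothField (leeVector P D)) (hX : IsSmoothField X)
    (hY : IsSmoothField Y) (p : M) : extDeriv (combForm P D a b) X Y p =
      b * (nablaForm D (leeForm P D) X Y p - nablaForm D (leeForm P D) Y X p)
      + a * (nablaForm D (leeForm P D) X (P.onField Y) p
        - nablaForm D (leeForm P D) Y (P.onField X) p) := by
  rw [extDeriv_combForm hΩ hX hY]
  have h1 := congrFun (hW.cov_onField (X := X) hY) p
  have h2 := congrFun (hW.cov_onField (X := Y) hX) p
  simp only [cov, Pi.add_apply, Pi.sub_apply, Pi.smul_apply, Pi.smul_apply'] at h1 h2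
  simp only [Pi.add_apply, Pi.smul_apply, smul_eq_mul, nablaForm, h1, h2, extDeriv, Pi.sub_apply,
    hD.mlieBracket_eq hX hY, map_add, map_sub, map_smul, leeFormP, ContinuousLinearMap.comp_apply,
    cov, AlmostProductStructure.onField, lieDer, innerFn, P.inner_swap, g.symm p (Y p)]
  ring

/-- On V_ε one has θ∘P = εθ, and [X,Y] stays in V_ε, so everything reduces to dθ(X,Y) = 0. -/
theorem IsW1Manifold.extDeriv_combForm_eq_zero [T2Space M] (hW : IsW1Manifold n P D) (hn : n ≠ 0)
    (hD : IsLeviCivita g D) (hE : 4 ≤ Module.finrank ℝ E)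
    (hε : ε * ε = 1) (hX : IsSmoothField X) (hY : IsSmoothField Y) (hPX : P.onField X = ε • X)
    (hPY : P.onField Y = ε • Y) : extDeriv (combForm P D a b) X Y = 0 := by
  have hΩ := hW.isSmoothField_leeVector hn hD hE
  have h0 := hW.extDeriv_leeForm_eq_zero hn hD hE hε hX hY hPX hPY
  have e : ∀ {Z : ∀ x : M, TangentSpace I x}, P.onField Z = ε • Z →
      (fun q => leeFormP P D q (Z q)) = ε • fun q => leeForm P D q (Z q) := by
    intro Z hZ
    funext q
    have : P q (Z q) = ε • Z q := congrFun hZ q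
    simp [leeFormP, this]
  have h1 : extDeriv (leeFormP P D) X Y = ε • extDeriv (leeForm P D) X Y := by
    simp only [extDeriv]
    rw [e hPX, e hPY, e (hW.mlieBracket_mem hD hε hX hY hPX hPY),
      lieDer_smul _ (isSmoothForm_leeForm hΩ hX), lieDer_smul _ (isSmoothForm_leeForm hΩ hY)]
    module
  rw [extDeriv_combForm hΩ hX hY, h1, h0]
  simp

/-! ### The connection `D'` -/

variable {lam mu : ℝ}

theorem cov_naturalConnection : cov (naturalConnection n P D lam mu) X Y = cov D X Y
    + innerFn g X (P.onField Y) • combField P D lam mu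
    - (fun q => combForm P D lam mu q (Y q)) • P.onField X
    + innerFn g X Y • combField P D (mu + 1 / (2 * (n : ℝ))) lam
    - (fun q => combForm P D (mu + 1 / (2 * (n : ℝ))) lam q (Y q)) • X := by
  funext p
  refine (naturalConnection_apply n P D lam mu X Y p).trans ?_
  simp only [Pi.add_apply, Pi.sub_apply, Pi.smul_apply, Pi.smul_apply', cov, innerFn, combField,
    combForm, leeFormP, AlmostProductStructure.onField, add_apply, smul_apply,
    ContinuousLinearMap.comp_apply, smul_eq_mul]
  module

theorem preservesSmooth_naturalConnection (hD : IsLeviCivita g D)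
    (hΩ : IsSmoothField (leeVector P D)) :
    PreservesSmooth (naturalConnection n P D lam mu) := by
  intro X Y hX hY
  rw [cov_naturalConnection]
  exact ((((hD.preservesSmooth hX hY).add_section
    ((hX.innerFn (hY.onField P)).smul_section (isSmoothField_combField hΩ _ _))).sub_section
    ((isSmoothForm_combForm hΩ _ _ hY).smul_section (hX.onField P))).add_section
    ((hX.innerFn hY).smul_section (isSmoothField_combField hΩ _ _))).sub_section
    ((isSmoothForm_combForm hΩ _ _ hY).smul_section hX)

/-- With A, B dual to α, β, the difference tensor is g(X,PY)A − α(Y)PX + g(X,Y)B − β(Y)X, which is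
skew in Y for each X. -/
theorem isMetric_naturalConnection (hD : IsLeviCivita g D) :
    IsMetric g (naturalConnection n P D lam mu) := by
  intro X Y Z hX hY hZ
  rw [hD.isMetric hX hY hZ, innerFn_comm (X := Y) (Y := cov (naturalConnection n P D lam mu) X Z),
    innerFn_comm (X := Y) (Y := cov D X Z)]
  simp only [cov_naturalConnection, innerFn_add_left, innerFn_sub_left, innerFn_smul_left,
    innerFn_combField, innerFn_onField_left]
  ring

/-- The λ and μ parts of the difference tensor commute with P. The extra 1/(2n) part has a
commutator with P that is exactly −∇P. -/
theorem IsW1Manifold.isParallel_naturalConnection (hW : IsW1Manifold n P D) :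
    IsParallel P (naturalConnection n P D lam mu) := by
  intro X Y _ hY
  rw [cov_naturalConnection, cov_naturalConnection, hW.cov_onField hY]
  funext p
  simp only [Pi.add_apply, Pi.sub_apply, Pi.smul_apply, Pi.smul_apply', innerFn, combField,
    combForm, leeFormP, AlmostProductStructure.onField, add_apply, smul_apply,
    ContinuousLinearMap.comp_apply, smul_eq_mul, P.involutive, map_add, map_sub, map_smul]
  module

theorem torsion_naturalConnection (hD : IsLeviCivita g D) (hX : IsSmoothField X)
    (hY : IsSmoothField Y) :
    cov (naturalConnection n P D lam mu) X Y = cov (naturalConnection n P D lam mu) Y X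
      + mlieBracket I X Y + ((fun q => combForm P D lam mu q (X q)) • P.onField Y
        - (fun q => combForm P D lam mu q (Y q)) • P.onField X
        + (fun q => combForm P D (mu + 1 / (2 * (n : ℝ))) lam q (X q)) • Y
        - (fun q => combForm P D (mu + 1 / (2 * (n : ℝ))) lam q (Y q)) • X) := by
  rw [cov_naturalConnection, cov_naturalConnection, hD.mlieBracket_eq hX hY,
    innerFn_comm (X := Y) (Y := X), ← innerFn_onField_left (X := Y),
    innerFn_comm (X := P.onField Y)]
  abel

/-! ### The Bianchi identity and the closedness of the forms -/

theorem IsW1Manifold.extDeriv_eq_zero_of_cyclic [T2Space M] (hW : IsW1Manifold n P D) (hn : n ≠ 0)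
    (hD : IsLeviCivita g D) (hE : 4 ≤ Module.finrank ℝ E) {a b a' b' : ℝ} (p : M)
    (h : ∀ {X Y Z : ∀ x : M, TangentSpace I x}, IsSmoothField X → IsSmoothField Y →
      IsSmoothField Z →
      extDeriv (combForm P D a b) X Y p • P p (Z p) + extDeriv (combForm P D a b) Y Z p • P p (X p)
        + extDeriv (combForm P D a b) Z X p • P p (Y p)
        + extDeriv (combForm P D a' b') X Y p • Z p + extDeriv (combForm P D a' b') Y Z p • X p
        + extDeriv (combForm P D a' b') Z X p • Y p = 0)
    (hX : IsSmoothField X) (hY : IsSmoothField Y) :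
    extDeriv (combForm P D a b) X Y p = 0 ∧ extDeriv (combForm P D a' b') X Y p = 0 := by
  have hΩ := hW.isSmoothField_leeVector hn hD hE
  have mixed : ∀ {ε : ℝ}, ε * ε = 1 → ∀ {X Y : ∀ x : M, TangentSpace I x}, IsSmoothField X →
      IsSmoothField Y → P.onField X = (-ε) • X → P.onField Y = ε • Y →
      extDeriv (combForm P D a' b') X Y p + ε * extDeriv (combForm P D a b) X Y p = 0 := by
    intro ε hε X Y hX hY hPX hPY
    -- Z(p) is orthogonal to Y(p) by choice and to X(p) by the opposite eigenvalue. Pairing with Z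
    -- therefore leaves only the terms with value on (X,Y).
    obtain ⟨Z, hZ, hPZ, hZp, hYZ⟩ := exists_eigenfield P hE hε p (Y p)
    have h1 := congrArg (fun v => g.inner p v (Z p)) (h hX hY hZ)
    have hXp : P p (X p) = (-ε) • X p := congrFun hPX p
    have hYp : P p (Y p) = ε • Y p := congrFun hPY p
    have hZp' : P p (Z p) = ε • Z p := congrFun hPZ p
    have hXZ : g.inner p (X p) (Z p) = 0 := by
      rw [g.symm]
      exact congrFun (innerFn_eq_zero hε hPZ hPX) p
    have hpos : g.inner p (Z p) (Z p) ≠ 0 := (g.pos p (Z p) hZp).ne'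
    simp only [hXp, hYp, hZp', map_add, map_smul, add_apply, smul_apply, smul_eq_mul, hYZ, hXZ,
      map_zero, zero_apply] at h1
    refine (mul_eq_zero.1 ?_).resolve_right hpos
    linear_combination h1
  -- Splitting X and Y into eigenparts, only the mixed components survive, and `mixed` handles both
  -- with the same sign ε. The cases ε = ±1 then separate dα from dβ.
  have comb : ∀ {ε : ℝ}, ε * ε = 1 →
      extDeriv (combForm P D a' b') X Y p + ε * extDeriv (combForm P D a b) X Y p = 0 := by
    intro ε hε
    have hε' : -ε * -ε = 1 := by linarith
    have split : ∀ a b : ℝ, extDeriv (combForm P D a b) X Y p =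
        extDeriv (combForm P D a b) (P.proj (-ε) X) (P.proj ε Y) p
        - extDeriv (combForm P D a b) (P.proj (-ε) Y) (P.proj ε X) p := by
      intro a b
      have hα : IsSmoothForm (combForm P D a b) := isSmoothForm_combForm hΩ a b
      have z1 := hW.extDeriv_combForm_eq_zero (a := a) (b := b) hn hD hE hε (hX.proj P ε)
        (hY.proj P ε) (onField_proj hε) (onField_proj hε)
      have z2 := hW.extDeriv_combForm_eq_zero (a := a) (b := b) hn hD hE hε' (hX.proj P (-ε))
        (hY.proj P (-ε)) (onField_proj hε') (onField_proj hε')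
      conv_lhs => rw [← proj_add_proj (P := P) (ε := ε) (X := X),
        ← proj_add_proj (P := P) (ε := ε) (X := Y)]
      rw [extDeriv_add_left hα (hX.proj P ε) (hX.proj P (-ε)),
        extDeriv_add_right hα (hY.proj P ε) (hY.proj P (-ε)),
        extDeriv_add_right hα (hY.proj P ε) (hY.proj P (-ε)), z1, z2,
        extDeriv_antisymm (P.proj ε X)]
      simp
      ring
    have m1 := mixed hε (hX.proj P (-ε)) (hY.proj P ε) (onField_proj hε') (onField_proj hε)
    have m2 := mixed hε (hY.proj P (-ε)) (hX.proj P ε) (onField_proj hε') (onField_proj hε)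
    rw [split a b, split a' b']
    linear_combination m1 - m2
  have c1 := comb (ε := 1) (by norm_num)
  have c2 := comb (ε := -1) (by norm_num)
  constructor <;> linarith

/-- Skewness and P-invariance hold unconditionally, so the equivalence concerns only the Bianchi
defect. -/
theorem IsW1Manifold.isRiemannianPTensor_iff [T2Space M] (hW : IsW1Manifold n P D) (hn : n ≠ 0)
    (hD : IsLeviCivita g D) (hE : 4 ≤ Module.finrank ℝ E) (lam mu : ℝ) :
    IsRiemannianPTensor P (curvature04 g (naturalConnection n P D lam mu)) ↔
      ∀ (Y Z : SmoothVectorField I M) (p : M),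
        extDeriv (combForm P D (mu + 1 / (2 * (n : ℝ))) lam) Y Z p = 0 ∧
        extDeriv (combForm P D lam mu) Y Z p = 0 := by
  have hΩ := hW.isSmoothField_leeVector hn hD hE
  have hs : PreservesSmooth (naturalConnection n P D lam mu) :=
    preservesSmooth_naturalConnection hD hΩ
  have hm : IsMetric g (naturalConnection n P D lam mu) := isMetric_naturalConnection hD
  have hP : IsParallel P (naturalConnection n P D lam mu) := hW.isParallel_naturalConnection
  have hB := fun {X Y Z : ∀ x : M, TangentSpace I x} (hX : IsSmoothField X)
    (hY : IsSmoothField Y) (hZ : IsSmoothField Z) (p : M) => congrFun (curvature_bianchi hs hP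
    (isSmoothForm_combForm hΩ lam mu) (isSmoothForm_combForm hΩ (mu + 1 / (2 * (n : ℝ))) lam)
    (fun hX hY => torsion_naturalConnection hD hX hY) hX hY hZ) p
  constructor
  · intro h Y Z p
    refine (hW.extDeriv_eq_zero_of_cyclic hn hD hE p ?_ Y.contMDiff Z.contMDiff).symm
    intro X Y Z hX hY hZ
    -- The scalar Bianchi identity against every W gives the vector identity, since each tangent
    -- vector extends to a smooth field.
    refine (hB hX hY hZ p).symm.trans (Metric.eq_of_inner_eq g fun w => ?_)
    obtain ⟨W, hW', rfl⟩ := exists_isSmoothField p w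
    have := h.curvatureLike.bianchi ⟨X, hX⟩ ⟨Y, hY⟩ ⟨Z, hZ⟩ ⟨W, hW'⟩ p
    simpa [curvature04] using this
  · intro h
    refine ⟨⟨fun X Y Z W p => ?_, fun X Y Z W p => ?_, fun X Y Z W p => ?_⟩, fun X Y Z W p => ?_⟩
    · rw [curvature04, curvature_antisymm_left]
      simp [curvature04]
    · exact congrFun (hm.curvature_skew hs X.contMDiff Y.contMDiff Z.contMDiff W.contMDiff) p
    · have h1 := hB X.contMDiff Y.contMDiff Z.contMDiff p
      simp only [Pi.add_apply, Pi.smul_apply', (h _ _ p).1, (h _ _ p).2, zero_smul, add_zero] at h1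
      have h2 := congrArg (fun v => g.inner p v (W p)) h1
      simpa [curvature04] using h2
    · have h1 := congrFun (hP.curvature hs X.contMDiff Y.contMDiff Z.contMDiff) p
      have h2 := congrArg (fun v => g.inner p v (P p (W p))) h1
      exact h2.trans (P.isometry p _ _)

end

end RiemannianAlmostProduct

end

theorem proposition4p2 (n : ℕ) (hn : 2 ≤ n)
    {M : Type*} [TopologicalSpace M] [T2Space M]
    [ChartedSpace (EuclideanSpace ℝ (Fin (2 * n))) M] [IsManifold (𝓡 (2 * n)) ∞ M]
    (g : RiemannianAlmostProduct.Metric (𝓡 (2 * n)) M)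
    (P : RiemannianAlmostProduct.AlmostProductStructure g)
    (D : RiemannianAlmostProduct.LinearConnection (𝓡 (2 * n)) M)
    (hD : RiemannianAlmostProduct.IsLeviCivita g D)
    (hW : RiemannianAlmostProduct.IsW1Manifold n P D)
    (lam mu : ℝ) :
    RiemannianAlmostProduct.IsRiemannianPTensor P
        (RiemannianAlmostProduct.curvature04 g
          (RiemannianAlmostProduct.naturalConnection n P D lam mu)) ↔
      ∀ (y z : RiemannianAlmostProduct.SmoothVectorField (𝓡 (2 * n)) M) (p : M),
        lam * (RiemannianAlmostProduct.nablaForm D (RiemannianAlmostProduct.leeForm P D) y z p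
              - RiemannianAlmostProduct.nablaForm D (RiemannianAlmostProduct.leeForm P D) z y p)
            + (mu + 1 / (2 * (n : ℝ))) *
              (RiemannianAlmostProduct.nablaForm D (RiemannianAlmostProduct.leeForm P D)
                  y (fun q => P q (z q)) p
                - RiemannianAlmostProduct.nablaForm D (RiemannianAlmostProduct.leeForm P D)
                  z (fun q => P q (y q)) p) = 0 ∧
          mu * (RiemannianAlmostProduct.nablaForm D (RiemannianAlmostProduct.leeForm P D) y z p
              - RiemannianAlmostProduct.nablaForm D (RiemannianAlmostProduct.leeForm P D) z y p)
            + lam *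
              (RiemannianAlmostProduct.nablaForm D (RiemannianAlmostProduct.leeForm P D)
                  y (fun q => P q (z q)) p
                - RiemannianAlmostProduct.nablaForm D (RiemannianAlmostProduct.leeForm P D)
                  z (fun q => P q (y q)) p) = 0 := by
  have hE : 4 ≤ Module.finrank ℝ (EuclideanSpace ℝ (Fin (2 * n))) := by
    rw [finrank_euclideanSpace_fin]; omega
  have hn0 : n ≠ 0 := by omega
  have hΩ := hW.isSmoothField_leeVector hn0 hD hE
  rw [hW.isRiemannianPTensor_iff hn0 hD hE]
  refine forall_congr' fun y => forall_congr' fun z => forall_congr' fun p => ?_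
  rw [hW.extDeriv_combForm_eq_nablaForm hD hΩ y.contMDiff z.contMDiff,
    hW.extDeriv_combForm_eq_nablaForm hD hΩ y.contMDiff z.contMDiff]
  rfl
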